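/- Let $\mathbb K$ be a field of characteristic $0$ and let $(A,P)$ be a complete filtered Rota--Baxter algebra of weight $\theta\in\mathbb K$, $\theta\neq 0$. That is, $A$ is a unital associative $\mathbb K$-algebra with a decreasing filtration $(A_n)_{n\ge 0}$ by two-sided ideals such that $A_mA_n\subseteq A_{m+n}$ and $A\cong\varprojlim A/A_n$, and $P:A\to A$ is a $\mathbb K$-linear map with $P(A_n)\subseteq A_n$ for all $n$ and $$P(x)P(y)+\theta P(xy)=P(xP(y))+P(P(x)y)\qquad (x,y\in A).$$ Put $\tilde P:=\theta\,\mathrm{id}_A-P$. For $u,v\in A_1$ let $\exp(u)=\sum_{n\ge0}u^n/n!$, and let $\mathrm{BCH}(u,v)\in A_1$ be the value at $(u,v)$ of the noncommutative power series $\mathrm{BCH}(x,y)=\log(\exp(x)\exp(y))-x-y$; all limits are taken in the topology defined by the filtration. Let $a\in A_1$. Then the sequence $\chi_{(0)}(a)=a$, $\chi_{(n+1)}(a)=a-\frac1\theta\mathrm{BCH}\big(P(\chi_{(n)}(a)),\tilde P(\chi_{(n)}(a))\big)$ converges to an element $\chi_\theta(a)\in A_1$, and $\chi_\theta(a)$ is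 the unique element $c\in A_1$ such that $$c=a-\tfrac1\theta\,\mathrm{BCH}\big(P(c),\tilde P(c)\big),$$ and also the unique element $c\in A_1$ such that $$c=a+\tfrac1\theta\,\mathrm{BCH}\big(-P(c),\theta a\big).$$ Moreover $$\exp(\theta a)=\exp\big(P(\chi_\theta(a))\big)\exp\big(\tilde P(\chi_\theta(a))\big),$$ and, with $b\in A_1$ defined by $1+\theta b=\exp(\theta a)$, each of the equations $$x=1-P(xb),\qquad x'=1-\tilde P(bx')$$ has exactly one solution in $A$; the solution $x$ is the two-sided inverse of $\exp(P(\chi_\theta(a)))$ and the solution $x'$ is the two-sided inverse of $\exp(\tilde P(\chi_\theta(a)))$. -/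

import Mathlib

/-! Complete filtered Rota-Baxter algebras, exponential and BCH series, and the
BCH-recursion of weight `θ`. -/

namespace RotaBaxterBCH

section Filtration

variable {A : Type*} [Ring A]

/-- `F` is a decreasing multiplicative filtration of `A` by two-sided ideals for which the
canonical map `A → lim A / F n` is injective (`eq_zero`) and surjective (`exists_lim`). -/
structure IsCompleteFiltration (F : ℕ → TwoSidedIdeal A) : Prop where
  antitone : Antitone F
  mul_mem : ∀ {m n : ℕ} {a b : A}, a ∈ F m → b ∈ F n → a * b ∈ F (m + n)
  eq_zero : ∀ a : A, (∀ n, a ∈ F n) → a = 0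
  exists_lim : ∀ s : ℕ → A, (∀ n, s (n + 1) - s n ∈ F n) → ∃ l : A, ∀ n, l - s n ∈ F n

/-- Convergence of a sequence in the topology defined by the filtration. -/
def ConvergesTo (F : ℕ → TwoSidedIdeal A) (s : ℕ → A) (l : A) : Prop :=
  ∀ N : ℕ, ∀ᶠ n in Filter.atTop, s n - l ∈ F N

/-- The limit of a sequence in the topology defined by the filtration
(an arbitrary value if the sequence does not converge). -/
noncomputable def limit (F : ℕ → TwoSidedIdeal A) (s : ℕ → A) : A :=
  Classical.epsilon (ConvergesTo F s)

theorem ConvergesTo.unique {F : ℕ → TwoSidedIdeal A} (hF : IsCompleteFiltration F)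
    {s : ℕ → A} {l l' : A} (h : ConvergesTo F s l) (h' : ConvergesTo F s l') : l = l' := by
  refine sub_eq_zero.mp (hF.eq_zero _ fun N => ?_)
  obtain ⟨n, h1, h2⟩ := ((h N).and (h' N)).exists
  have := (F N).sub_mem h2 h1
  rwa [sub_sub_sub_cancel_left] at this

theorem convergesTo_limit {F : ℕ → TwoSidedIdeal A} {s : ℕ → A}
    (h : ∃ l, ConvergesTo F s l) : ConvergesTo F s (limit F s) :=
  Classical.epsilon_spec h

/-- A series whose `n`-th term lies in `F n` for `n ≥ 1` converges. -/
theorem convergesTo_series {F : ℕ → TwoSidedIdeal A} (hF : IsCompleteFiltration F)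
    {t : ℕ → A} (ht : ∀ n, 1 ≤ n → t n ∈ F n) :
    ConvergesTo F (fun N => ∑ n ∈ Finset.range N, t n)
      (limit F (fun N => ∑ n ∈ Finset.range N, t n)) := by
  apply convergesTo_limit
  obtain ⟨l, hl⟩ := hF.exists_lim (fun N => ∑ n ∈ Finset.range (N + 1), t n) (fun n => by
    rw [Finset.sum_range_succ _ (n + 1), add_sub_cancel_left]
    exact hF.antitone (Nat.le_succ n) (ht _ (by omega)))
  refine ⟨l, fun N => ?_⟩
  filter_upwards [Filter.eventually_ge_atTop (N + 1)] with n hn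
  obtain ⟨m, rfl⟩ : ∃ m, n = m + 1 := ⟨n - 1, by omega⟩
  have h := (F N).neg_mem (hF.antitone (by omega : N ≤ m) (hl m))
  rwa [neg_sub] at h

end Filtration

section Algebra

variable {A : Type*} [Ring A] (K : Type*) [Field K] [Algebra K A]

/-- The exponential series `∑ aⁿ / n!`, summed in the topology of the filtration. -/
noncomputable def exp (F : ℕ → TwoSidedIdeal A) (a : A) : A :=
  limit F fun N => ∑ n ∈ Finset.range N, ((n.factorial : K)⁻¹) • a ^ n

/-- Noncommutative formal power series in two variables are represented by their homogeneous
components: the component of degree `n` is the coefficient of `tⁿ` of a power series in `t` over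
the free algebra `K⟨x, y⟩`. For `w` of degree one this is `exp (t w)`. -/
noncomputable def formalExp (w : FreeAlgebra K (Fin 2)) : PowerSeries (FreeAlgebra K (Fin 2)) :=
  PowerSeries.mk fun n => ((n.factorial : K)⁻¹) • w ^ n

/-- The logarithm `∑_{k ≥ 1} (-1)^(k+1) (f - 1)^k / k` of a series `f` with constant term `1`;
the powers `k > n` do not contribute to the coefficient of degree `n`. -/
noncomputable def formalLog (f : PowerSeries (FreeAlgebra K (Fin 2))) :
    PowerSeries (FreeAlgebra K (Fin 2)) :=
  PowerSeries.mk fun n =>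
    ∑ k ∈ Finset.Icc 1 n, ((-1 : K) ^ (k + 1) / (k : K)) • PowerSeries.coeff n ((f - 1) ^ k)

/-- The degree `n` component of `BCH(x, y) = log (exp x * exp y) - x - y`. -/
noncomputable def bchComponent (n : ℕ) : FreeAlgebra K (Fin 2) :=
  PowerSeries.coeff n
      (formalLog K (formalExp K (FreeAlgebra.ι K 0) * formalExp K (FreeAlgebra.ι K 1)))
    - (if n = 1 then FreeAlgebra.ι K 0 + FreeAlgebra.ι K 1 else 0)

/-- The value `BCH(u, v)`: the components of the BCH series are evaluated at `x = u`, `y = v`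
and summed in the topology of the filtration. -/
noncomputable def BCH (F : ℕ → TwoSidedIdeal A) (u v : A) : A :=
  limit F fun N => ∑ n ∈ Finset.range N, FreeAlgebra.lift K ![u, v] (bchComponent K n)

variable {K}

theorem smul_mem_filtration (I : TwoSidedIdeal A) (k : K) {a : A} (ha : a ∈ I) : k • a ∈ I := by
  rw [Algebra.smul_def]
  exact I.mul_mem_left _ _ ha

theorem pow_mem_filtration {F : ℕ → TwoSidedIdeal A} (hF : IsCompleteFiltration F) {a : A}
    (ha : a ∈ F 1) : ∀ n, 1 ≤ n → a ^ n ∈ F n := by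
  intro n hn
  induction n, hn using Nat.le_induction with
  | base => simpa using ha
  | succ n _ ih => rw [pow_succ]; exact hF.mul_mem ih ha

/-- The exponential series converges on `F 1`. -/
theorem convergesTo_exp {F : ℕ → TwoSidedIdeal A} (hF : IsCompleteFiltration F) {a : A}
    (ha : a ∈ F 1) :
    ConvergesTo F (fun N => ∑ n ∈ Finset.range N, ((n.factorial : K)⁻¹) • a ^ n) (exp K F a) :=
  convergesTo_series hF fun n hn => smul_mem_filtration _ _ (pow_mem_filtration hF ha n hn)

/-- The series over `K⟨x, y⟩` whose component of degree `n` takes values in `F n` at `(u, v)`. -/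
def Adapted (F : ℕ → TwoSidedIdeal A) (u v : A) (f : PowerSeries (FreeAlgebra K (Fin 2))) : Prop :=
  (∃ k : K, PowerSeries.coeff 0 f = algebraMap K _ k) ∧
    ∀ n, 1 ≤ n → FreeAlgebra.lift K ![u, v] (PowerSeries.coeff n f) ∈ F n

theorem Adapted.mul {F : ℕ → TwoSidedIdeal A} (hF : IsCompleteFiltration F) {u v : A}
    {f g : PowerSeries (FreeAlgebra K (Fin 2))} (hf : Adapted F u v f) (hg : Adapted F u v g) :
    Adapted F u v (f * g) := by
  obtain ⟨⟨k, hk⟩, hf⟩ := hf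
  obtain ⟨⟨l, hl⟩, hg⟩ := hg
  refine ⟨⟨k * l, by simp [PowerSeries.coeff_mul, hk, hl]⟩, fun n hn => ?_⟩
  rw [PowerSeries.coeff_mul, map_sum]
  refine sum_mem fun p hp => ?_
  rw [Finset.HasAntidiagonal.mem_antidiagonal] at hp
  rw [map_mul]
  rcases Nat.eq_zero_or_pos p.1 with h1 | h1
  · rw [h1, hk, AlgHom.commutes]
    exact (F n).mul_mem_left _ _ (by simpa [show p.2 = n by omega] using hg p.2 (by omega))
  rcases Nat.eq_zero_or_pos p.2 with h2 | h2
  · rw [h2, hl, AlgHom.commutes]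
    exact (F n).mul_mem_right _ _ (by simpa [show p.1 = n by omega] using hf p.1 (by omega))
  · rw [← hp]
    exact hF.mul_mem (hf _ h1) (hg _ h2)

theorem adapted_one (F : ℕ → TwoSidedIdeal A) (u v : A) :
    Adapted F u v (1 : PowerSeries (FreeAlgebra K (Fin 2))) := by
  refine ⟨⟨1, by simp⟩, fun n hn => ?_⟩
  rw [PowerSeries.coeff_one, if_neg (by omega), map_zero]
  exact (F n).zero_mem

theorem adapted_formalExp {F : ℕ → TwoSidedIdeal A} (hF : IsCompleteFiltration F) {u v : A}
    {w : FreeAlgebra K (Fin 2)} (hw : FreeAlgebra.lift K ![u, v] w ∈ F 1) :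
    Adapted F u v (formalExp K w) := by
  refine ⟨⟨1, by simp [formalExp]⟩, fun n hn => ?_⟩
  rw [formalExp, PowerSeries.coeff_mk, map_smul, map_pow]
  exact smul_mem_filtration _ _ (pow_mem_filtration hF hw n hn)

theorem adapted_formalLog {F : ℕ → TwoSidedIdeal A} (hF : IsCompleteFiltration F) {u v : A}
    {f : PowerSeries (FreeAlgebra K (Fin 2))} (hf : Adapted F u v f) :
    Adapted F u v (formalLog K f) := by
  have h1 : Adapted F u v (f - 1) := by
    obtain ⟨⟨k, hk⟩, hf⟩ := hf
    refine ⟨⟨k - 1, by simpa using hk⟩, fun n hn => ?_⟩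
    rw [map_sub, map_sub]
    exact (F n).sub_mem (hf n hn) ((adapted_one F u v).2 n hn)
  have h2 : ∀ k : ℕ, Adapted F u v ((f - 1) ^ k) := by
    intro k
    induction k with
    | zero => rw [pow_zero]; exact adapted_one F u v
    | succ k ih => rw [pow_succ]; exact ih.mul hF h1
  refine ⟨⟨0, by simp [formalLog]⟩, fun n hn => ?_⟩
  rw [formalLog, PowerSeries.coeff_mk, map_sum]
  refine sum_mem fun k _ => ?_
  rw [map_smul]
  exact smul_mem_filtration _ _ ((h2 k).2 n hn)

/-- The BCH series converges on `F 1 × F 1`. -/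
theorem convergesTo_BCH {F : ℕ → TwoSidedIdeal A} (hF : IsCompleteFiltration F) {u v : A}
    (hu : u ∈ F 1) (hv : v ∈ F 1) :
    ConvergesTo F
      (fun N => ∑ n ∈ Finset.range N, FreeAlgebra.lift K ![u, v] (bchComponent K n))
      (BCH K F u v) := by
  have hx : FreeAlgebra.lift K ![u, v] (FreeAlgebra.ι K 0) ∈ F 1 := by simpa using hu
  have hy : FreeAlgebra.lift K ![u, v] (FreeAlgebra.ι K 1) ∈ F 1 := by simpa using hv
  refine convergesTo_series hF fun n hn => ?_
  rw [bchComponent, map_sub]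
  refine (F n).sub_mem ((adapted_formalLog hF
    ((adapted_formalExp hF hx).mul hF (adapted_formalExp hF hy))).2 n hn) ?_
  split_ifs with h
  · rw [h, map_add]
    exact (F 1).add_mem hx hy
  · rw [map_zero]
    exact (F n).zero_mem

/-- `P` is a Rota-Baxter operator of weight `θ`. -/
def IsRotaBaxter (θ : K) (P : A →ₗ[K] A) : Prop :=
  ∀ x y : A, P x * P y + θ • P (x * y) = P (x * P y) + P (P x * y)

/-- A complete filtered Rota-Baxter algebra of weight `θ`: the filtration is complete and
consists of Rota-Baxter ideals. -/
structure IsCompleteFilteredRotaBaxter (F : ℕ → TwoSidedIdeal A) (θ : K) (P : A →ₗ[K] A) :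
    Prop where
  complete : IsCompleteFiltration F
  rotaBaxter : IsRotaBaxter θ P
  map_mem : ∀ (n : ℕ) (a : A), a ∈ F n → P a ∈ F n

/-- The operator `θ id - P`. -/
def tildeOp (θ : K) (P : A →ₗ[K] A) : A →ₗ[K] A := θ • LinearMap.id - P

/-- The iterates of the BCH-recursion of weight `θ`, starting at `a`. -/
noncomputable def chiIter (F : ℕ → TwoSidedIdeal A) (θ : K) (P : A →ₗ[K] A) (a : A) : ℕ → A
  | 0 => a
  | n + 1 => a - θ⁻¹ • BCH K F (P (chiIter F θ P a n)) (tildeOp θ P (chiIter F θ P a n))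

/-- The BCH-recursion of weight `θ`, as the limit of its iterates. -/
noncomputable def chi (F : ℕ → TwoSidedIdeal A) (θ : K) (P : A →ₗ[K] A) (a : A) : A :=
  limit F (chiIter F θ P a)

end Algebra

end RotaBaxterBCH

/-! On `F 1` the exponential and logarithm are inverse bijections onto `1 + F 1`, so `BCH u v = log
(exp u * exp v) - u - v` (`BCH_eq`). Since `P c + tildeOp θ P c = θ • c`, taking logarithms shows
that the fixed point equation for `c` says exactly that `exp (θ a)` factors as `exp (P c) * exp
(tildeOp θ P c)`. Multiplying by `exp (-P c)` first gives the second recursive equation, so both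
equations have the same solutions.

The BCH series has no linear part, hence it turns a congruence modulo `F n` into one modulo `F (n +
1)` (`BCH_sub_BCH_mem`). One step of the recursion is therefore a contraction, and completeness
gives convergence and uniqueness.

For the linear equations, `P` and `-tildeOp θ P` are both multiplicative from the double product `P
x * y + x * P y - θ • x * y` to the product of `A`. Applied to an exponential-type series in the
double powers of `c`, they give a single `d` with `exp (-P c) = 1 + P d` and `exp (tildeOp θ P c) =
1 - tildeOp θ P d` (`exists_exp_neg_eq`). Comparing with the factorization of `1 + θ b` yields `exp
(-P c) * b = -d`, which is the first linear equation; the second is the same argument for `tildeOp θ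
P`. Uniqueness is again contraction, because `b ∈ F 1`. -/

namespace RotaBaxterBCH

/-! ### Summation of power series over `A` in the filtration topology -/

section Series

variable {A : Type*} [Ring A] {F : ℕ → TwoSidedIdeal A}

/-- Only `N ≥ 1` is required because `F 0` is not assumed to be all of `A`, and estimates for series
start in degree one. -/
theorem IsCompleteFiltration.eq_of_sub_mem (hF : IsCompleteFiltration F) {a b : A}
    (h : ∀ N, 1 ≤ N → a - b ∈ F N) : a = b :=
  sub_eq_zero.mp <| hF.eq_zero _ fun N =>
    hF.antitone (Nat.le_succ N) (h (N + 1) (Nat.le_add_left 1 N))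

theorem sub_mem_trans {I : TwoSidedIdeal A} {a b c : A} (h : a - b ∈ I) (h' : b - c ∈ I) :
    a - c ∈ I := by
  simpa using I.add_mem h h'

theorem sub_mem_symm {I : TwoSidedIdeal A} {a b : A} (h : a - b ∈ I) : b - a ∈ I := by
  simpa using I.neg_mem h

theorem mul_sub_mul_mem {I : TwoSidedIdeal A} {a b c d : A} (h : a - b ∈ I) (h' : c - d ∈ I) :
    a * c - b * d ∈ I := by
  have e : a * c - b * d = (a - b) * c + b * (c - d) := by noncomm_ring
  rw [e]
  exact I.add_mem (I.mul_mem_right _ _ h) (I.mul_mem_left _ _ h')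

/-- The `n`-th coefficient of the series lies in `F n` for `n ≥ 1`. -/
def SeriesAdapted (F : ℕ → TwoSidedIdeal A) (g : PowerSeries A) : Prop :=
  ∀ n, 1 ≤ n → PowerSeries.coeff n g ∈ F n

/-- The sum of the coefficients of a series, in the topology of the filtration. -/
noncomputable def seriesSum (F : ℕ → TwoSidedIdeal A) (g : PowerSeries A) : A :=
  limit F fun N => ∑ n ∈ Finset.range N, PowerSeries.coeff n g

theorem sum_range_sub_sum_range_mem (hF : IsCompleteFiltration F) {t : ℕ → A}
    (ht : ∀ n, 1 ≤ n → t n ∈ F n) {N M : ℕ} (hN : 1 ≤ N) (hM : N ≤ M) :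
    ∑ n ∈ Finset.range M, t n - ∑ n ∈ Finset.range N, t n ∈ F N := by
  rw [← Finset.sum_Ico_eq_sub _ hM]
  refine sum_mem fun n hn => ?_
  rw [Finset.mem_Ico] at hn
  exact hF.antitone hn.1 (ht n (by omega))

theorem sum_range_sub_limit_mem (hF : IsCompleteFiltration F) {t : ℕ → A}
    (ht : ∀ n, 1 ≤ n → t n ∈ F n) {N : ℕ} (hN : 1 ≤ N) :
    ∑ n ∈ Finset.range N, t n - limit F (fun N => ∑ n ∈ Finset.range N, t n) ∈ F N := by
  obtain ⟨M, hM, h⟩ := ((Filter.eventually_ge_atTop N).and (convergesTo_series hF ht N)).exists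
  exact sub_mem_trans (sub_mem_symm (sum_range_sub_sum_range_mem hF ht hN hM)) h

theorem sum_range_sub_seriesSum_mem (hF : IsCompleteFiltration F) {g : PowerSeries A}
    (hg : SeriesAdapted F g) {N : ℕ} (hN : 1 ≤ N) :
    ∑ n ∈ Finset.range N, PowerSeries.coeff n g - seriesSum F g ∈ F N :=
  sum_range_sub_limit_mem hF hg hN

theorem seriesSum_eq (hF : IsCompleteFiltration F) {g : PowerSeries A} (hg : SeriesAdapted F g)
    {l : A} (h : ∀ N, 1 ≤ N → ∑ n ∈ Finset.range N, PowerSeries.coeff n g - l ∈ F N) :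
    seriesSum F g = l :=
  hF.eq_of_sub_mem fun N hN =>
    sub_mem_trans (sub_mem_symm (sum_range_sub_seriesSum_mem hF hg hN)) (h N hN)

theorem seriesSum_sub_coeff_zero_mem (hF : IsCompleteFiltration F) {g : PowerSeries A}
    (hg : SeriesAdapted F g) : seriesSum F g - PowerSeries.coeff 0 g ∈ F 1 := by
  simpa using sub_mem_symm (sum_range_sub_seriesSum_mem hF hg le_rfl)

theorem SeriesAdapted.add {g h : PowerSeries A} (hg : SeriesAdapted F g)
    (hh : SeriesAdapted F h) : SeriesAdapted F (g + h) := fun n hn => by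
  rw [map_add]; exact (F n).add_mem (hg n hn) (hh n hn)

theorem SeriesAdapted.sub {g h : PowerSeries A} (hg : SeriesAdapted F g)
    (hh : SeriesAdapted F h) : SeriesAdapted F (g - h) := fun n hn => by
  rw [map_sub]; exact (F n).sub_mem (hg n hn) (hh n hn)

theorem SeriesAdapted.mul (hF : IsCompleteFiltration F) {g h : PowerSeries A}
    (hg : SeriesAdapted F g) (hh : SeriesAdapted F h) : SeriesAdapted F (g * h) := by
  intro n hn
  rw [PowerSeries.coeff_mul]
  refine sum_mem fun p hp => ?_
  rw [Finset.HasAntidiagonal.mem_antidiagonal] at hp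
  rcases Nat.eq_zero_or_pos p.1 with h1 | h1
  · exact (F n).mul_mem_left _ _ (by simpa [show p.2 = n by omega] using hh p.2 (by omega))
  rcases Nat.eq_zero_or_pos p.2 with h2 | h2
  · exact (F n).mul_mem_right _ _ (by simpa [show p.1 = n by omega] using hg p.1 (by omega))
  · rw [← hp]
    exact hF.mul_mem (hg _ h1) (hh _ h2)

theorem seriesAdapted_one (F : ℕ → TwoSidedIdeal A) : SeriesAdapted F (1 : PowerSeries A) := by
  intro n hn
  rw [PowerSeries.coeff_one, if_neg (by omega)]
  exact (F n).zero_mem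

theorem SeriesAdapted.pow (hF : IsCompleteFiltration F) {g : PowerSeries A}
    (hg : SeriesAdapted F g) (k : ℕ) : SeriesAdapted F (g ^ k) := by
  induction k with
  | zero => rw [pow_zero]; exact seriesAdapted_one F
  | succ k ih => rw [pow_succ]; exact ih.mul hF hg

theorem seriesSum_add (hF : IsCompleteFiltration F) {g h : PowerSeries A}
    (hg : SeriesAdapted F g) (hh : SeriesAdapted F h) :
    seriesSum F (g + h) = seriesSum F g + seriesSum F h := by
  refine seriesSum_eq hF (hg.add hh) fun N hN => ?_
  simp only [map_add, Finset.sum_add_distrib, add_sub_add_comm]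
  exact (F N).add_mem (sum_range_sub_seriesSum_mem hF hg hN)
    (sum_range_sub_seriesSum_mem hF hh hN)

theorem seriesSum_eq_coeff (hF : IsCompleteFiltration F) {g : PowerSeries A} (k : ℕ)
    (hg : ∀ n, n ≠ k → PowerSeries.coeff n g = 0) (hk : PowerSeries.coeff k g ∈ F k) :
    seriesSum F g = PowerSeries.coeff k g := by
  have had : SeriesAdapted F g := fun n _ => by
    rcases eq_or_ne n k with rfl | h
    · exact hk
    · rw [hg n h]; exact (F n).zero_mem
  refine seriesSum_eq hF had fun N hN => ?_
  rcases lt_or_ge k N with h | h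
  · rw [Finset.sum_eq_single_of_mem k (Finset.mem_range.mpr h) fun n _ hn => hg n hn, sub_self]
    exact (F N).zero_mem
  · rw [Finset.sum_eq_zero fun n hn => hg n (by rw [Finset.mem_range] at hn; omega), zero_sub]
    exact (F N).neg_mem (hF.antitone h hk)

theorem seriesSum_one (hF : IsCompleteFiltration F) : seriesSum F (1 : PowerSeries A) = 1 := by
  refine seriesSum_eq hF (seriesAdapted_one F) fun N hN => ?_
  rw [Finset.sum_eq_single_of_mem 0 (Finset.mem_range.mpr hN) fun n _ hn => by
    rw [PowerSeries.coeff_one, if_neg hn]]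
  simp

/-- The product of two partial sums runs over a square of index pairs, the partial sum of the Cauchy
product over the triangle `p.1 + p.2 < N`; the remaining terms have total degree at least `N`. -/
theorem seriesSum_mul (hF : IsCompleteFiltration F) {g h : PowerSeries A}
    (hg : SeriesAdapted F g) (hh : SeriesAdapted F h) :
    seriesSum F (g * h) = seriesSum F g * seriesSum F h := by
  refine seriesSum_eq hF (hg.mul hF hh) fun N hN => ?_
  refine sub_mem_trans ?_ (mul_sub_mul_mem (sum_range_sub_seriesSum_mem hF hg hN)
    (sum_range_sub_seriesSum_mem hF hh hN))
  have e : ∑ n ∈ Finset.range N, PowerSeries.coeff n (g * h) =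
      ∑ p ∈ Finset.range N ×ˢ Finset.range N with p.1 + p.2 < N,
        PowerSeries.coeff p.1 g * PowerSeries.coeff p.2 h := by
    rw [← Finset.sum_fiberwise_of_maps_to (t := Finset.range N) (g := fun p : ℕ × ℕ => p.1 + p.2)
      (fun p hp => Finset.mem_range.mpr (Finset.mem_filter.mp hp).2)]
    refine Finset.sum_congr rfl fun n hn => ?_
    rw [PowerSeries.coeff_mul]
    refine Finset.sum_congr ?_ fun _ _ => rfl
    ext p
    simp only [Finset.mem_range] at hn
    simp only [Finset.HasAntidiagonal.mem_antidiagonal, Finset.mem_filter, Finset.mem_product,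
      Finset.mem_range]
    omega
  rw [e, Finset.sum_mul_sum, ← Finset.sum_product',
    ← Finset.sum_filter_add_sum_filter_not (Finset.range N ×ˢ Finset.range N)
      (fun p => p.1 + p.2 < N), sub_add_cancel_left]
  refine (F N).neg_mem (sum_mem fun p hp => ?_)
  simp only [Finset.mem_filter, Finset.mem_product, Finset.mem_range] at hp
  exact hF.antitone (by omega) (hF.mul_mem (hg p.1 (by omega)) (hh p.2 (by omega)))

theorem seriesSum_pow (hF : IsCompleteFiltration F) {g : PowerSeries A}
    (hg : SeriesAdapted F g) (k : ℕ) : seriesSum F (g ^ k) = seriesSum F g ^ k := by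
  induction k with
  | zero => rw [pow_zero, pow_zero, seriesSum_one hF]
  | succ k ih => rw [pow_succ, pow_succ, seriesSum_mul hF (hg.pow hF k) hg, ih]

theorem seriesSum_sub (hF : IsCompleteFiltration F) {g h : PowerSeries A}
    (hg : SeriesAdapted F g) (hh : SeriesAdapted F h) :
    seriesSum F (g - h) = seriesSum F g - seriesSum F h := by
  rw [eq_sub_iff_add_eq, ← seriesSum_add hF (hg.sub hh) hh, sub_add_cancel]

theorem coeff_pow_eq_zero {H : PowerSeries A} (h0 : PowerSeries.coeff 0 H = 0) {n k : ℕ}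
    (h : n < k) : PowerSeries.coeff n (H ^ k) = 0 := by
  refine PowerSeries.coeff_of_lt_order _ (lt_of_lt_of_le (by exact_mod_cast h)
    (PowerSeries.le_order_pow_of_constantCoeff_eq_zero k ?_))
  rwa [PowerSeries.coeff_zero_eq_constantCoeff_apply] at h0

/-! ### Evaluation and composition of one-variable power series on `F 1` -/

section Evaluation

variable {K : Type*} [Field K] [Algebra K A]

/-- The series `c (s t)` in the variable `t`, with coefficients in `A`. -/
noncomputable def scaleAt (c : PowerSeries K) (s : A) : PowerSeries A :=
  PowerSeries.mk fun n => PowerSeries.coeff n c • s ^ n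

/-- The value at `s` of a power series in one variable. -/
noncomputable def evalAt (F : ℕ → TwoSidedIdeal A) (c : PowerSeries K) (s : A) : A :=
  seriesSum F (scaleAt c s)

theorem coeff_scaleAt (c : PowerSeries K) (s : A) (n : ℕ) :
    PowerSeries.coeff n (scaleAt c s) = PowerSeries.coeff n c • s ^ n := PowerSeries.coeff_mk _ _

theorem seriesAdapted_scaleAt (hF : IsCompleteFiltration F) (c : PowerSeries K) {s : A}
    (hs : s ∈ F 1) : SeriesAdapted F (scaleAt c s) := fun n hn => by
  rw [coeff_scaleAt]
  exact smul_mem_filtration _ _ (pow_mem_filtration hF hs n hn)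

theorem scaleAt_one (s : A) : scaleAt (1 : PowerSeries K) s = 1 := by
  ext n
  rw [coeff_scaleAt, PowerSeries.coeff_one, PowerSeries.coeff_one]
  split_ifs with h <;> simp [h]

theorem scaleAt_sub (c d : PowerSeries K) (s : A) :
    scaleAt (c - d) s = scaleAt c s - scaleAt d s := by
  ext n
  simp only [coeff_scaleAt, map_sub, sub_smul]

theorem scaleAt_mul (c d : PowerSeries K) (s : A) :
    scaleAt (c * d) s = scaleAt c s * scaleAt d s := by
  ext n
  rw [coeff_scaleAt, PowerSeries.coeff_mul, PowerSeries.coeff_mul, Finset.sum_smul]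
  refine Finset.sum_congr rfl fun p hp => ?_
  rw [Finset.HasAntidiagonal.mem_antidiagonal] at hp
  rw [coeff_scaleAt, coeff_scaleAt, smul_mul_smul_comm, ← pow_add, hp]

theorem scaleAt_pow (c : PowerSeries K) (s : A) (k : ℕ) :
    scaleAt (c ^ k) s = scaleAt c s ^ k := by
  induction k with
  | zero => rw [pow_zero, pow_zero, scaleAt_one]
  | succ k ih => rw [pow_succ, pow_succ, scaleAt_mul, ih]

theorem evalAt_mem (hF : IsCompleteFiltration F) {c : PowerSeries K}
    (hc : PowerSeries.coeff 0 c = 0) {s : A} (hs : s ∈ F 1) : evalAt F c s ∈ F 1 := by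
  simpa [coeff_scaleAt, hc, evalAt] using
    seriesSum_sub_coeff_zero_mem hF (seriesAdapted_scaleAt hF c hs)

/-- Evaluation of a composite series. -/
theorem seriesSum_comp (hF : IsCompleteFiltration F) (c : PowerSeries K) {H : PowerSeries A}
    (hH : SeriesAdapted F H) (h0 : PowerSeries.coeff 0 H = 0) :
    seriesSum F (PowerSeries.mk fun n =>
      ∑ k ∈ Finset.range (n + 1), PowerSeries.coeff k c • PowerSeries.coeff n (H ^ k)) =
      evalAt F c (seriesSum F H) := by
  have hs : seriesSum F H ∈ F 1 := by
    simpa [h0] using seriesSum_sub_coeff_zero_mem hF hH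
  refine seriesSum_eq hF (fun n hn => ?_) fun N hN => ?_
  · rw [PowerSeries.coeff_mk]
    exact sum_mem fun k _ => smul_mem_filtration _ _ (hH.pow hF k n hn)
  refine sub_mem_trans ?_ (sum_range_sub_seriesSum_mem hF (seriesAdapted_scaleAt hF c hs) hN)
  have e : ∑ n ∈ Finset.range N, PowerSeries.coeff n (PowerSeries.mk fun n =>
      ∑ k ∈ Finset.range (n + 1), PowerSeries.coeff k c • PowerSeries.coeff n (H ^ k)) =
      ∑ k ∈ Finset.range N, PowerSeries.coeff k c •
        ∑ n ∈ Finset.range N, PowerSeries.coeff n (H ^ k) := by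
    simp only [PowerSeries.coeff_mk, Finset.smul_sum]
    rw [Finset.sum_comm (s := Finset.range N) (t := Finset.range N)]
    refine Finset.sum_congr rfl fun n hn => ?_
    rw [Finset.mem_range] at hn
    -- The inner range can be enlarged to length `N`: as `H` has no constant term, `H ^ k` has no
    -- coefficient in degree `n < k`.
    refine Finset.sum_subset (Finset.range_mono hn) fun k _ hk => ?_
    rw [Finset.mem_range, not_lt] at hk
    rw [coeff_pow_eq_zero h0 hk, smul_zero]
  rw [e, ← Finset.sum_sub_distrib]
  refine sum_mem fun k _ => ?_
  rw [coeff_scaleAt, ← smul_sub, ← seriesSum_pow hF hH]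
  exact smul_mem_filtration _ _ (sum_range_sub_seriesSum_mem hF (hH.pow hF k) hN)

/-- This transports formal identities between series over `K` to identities in `A`. It is
`seriesSum_comp` for `H = scaleAt d s`, whose powers are `scaleAt (d ^ k) s`. -/
theorem evalAt_subst (hF : IsCompleteFiltration F) (c d : PowerSeries K)
    (hd : PowerSeries.coeff 0 d = 0) {s : A} (hs : s ∈ F 1) :
    evalAt F (c.subst d) s = evalAt F c (evalAt F d s) := by
  have h0 : PowerSeries.coeff 0 (scaleAt d s) = 0 := by rw [coeff_scaleAt, hd, zero_smul]
  rw [evalAt, show evalAt F d s = seriesSum F (scaleAt d s) from rfl,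
    ← seriesSum_comp hF c (seriesAdapted_scaleAt hF d hs) h0]
  congr 1
  ext n
  have hd' : PowerSeries.HasSubst d := PowerSeries.HasSubst.of_constantCoeff_zero'
    (by rwa [← PowerSeries.coeff_zero_eq_constantCoeff_apply])
  rw [PowerSeries.coeff_mk, coeff_scaleAt, PowerSeries.coeff_subst' hd',
    finsum_eq_sum_of_support_subset (s := Finset.range (n + 1)), Finset.sum_smul]
  · refine Finset.sum_congr rfl fun k _ => ?_
    rw [← scaleAt_pow, coeff_scaleAt, smul_smul, smul_eq_mul]
  · intro k hk
    rw [Finset.coe_range, Set.mem_Iio]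
    by_contra hlt
    exact hk (by simp only [coeff_pow_eq_zero hd (show n < k by omega), smul_zero])

theorem pow_sub_pow_mem_succ (hF : IsCompleteFiltration F) {s s' : A} (hs : s ∈ F 1)
    (hs' : s' ∈ F 1) {n : ℕ} (h : s - s' ∈ F n) (k : ℕ) :
    s ^ (k + 1) - s' ^ (k + 1) ∈ F (n + k) := by
  induction k with
  | zero => simpa using h
  | succ k ih =>
    have e : s ^ (k + 1 + 1) - s' ^ (k + 1 + 1) =
        (s ^ (k + 1) - s' ^ (k + 1)) * s + s' ^ (k + 1) * (s - s') := by
      rw [pow_succ s (k + 1), pow_succ s' (k + 1)]; noncomm_ring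
    rw [e]
    refine (F _).add_mem (by rw [← add_assoc]; exact hF.mul_mem ih hs) ?_
    have := hF.mul_mem (pow_mem_filtration hF hs' (k + 1) (by omega)) h
    rwa [add_comm (k + 1)] at this

/-- First-order expansion: for `k ≥ 2` the difference of `k`-th powers gains `k - 1 ≥ 1` steps of
the filtration over `s - s'`, so only the linear term survives modulo `F (n + 1)`. -/
theorem evalAt_sub_evalAt_mem (hF : IsCompleteFiltration F) (c : PowerSeries K) {s s' : A}
    (hs : s ∈ F 1) (hs' : s' ∈ F 1) {n : ℕ} (h : s - s' ∈ F n) :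
    evalAt F c s - evalAt F c s' - PowerSeries.coeff 1 c • (s - s') ∈ F (n + 1) := by
  -- Truncating at `n + 2` rather than `n + 1` keeps the linear term in the partial sum even when `n
  -- = 0`.
  have hS := sub_mem_symm (sum_range_sub_seriesSum_mem hF (seriesAdapted_scaleAt hF c hs)
    (show 1 ≤ n + 1 + 1 by omega))
  have hS' := sub_mem_symm (sum_range_sub_seriesSum_mem hF (seriesAdapted_scaleAt hF c hs')
    (show 1 ≤ n + 1 + 1 by omega))
  have h1 := hF.antitone (Nat.le_succ (n + 1)) ((F _).sub_mem hS hS')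
  rw [sub_sub_sub_comm] at h1
  have h2 : ∑ k ∈ Finset.range (n + 1 + 1), PowerSeries.coeff k (scaleAt c s) -
      ∑ k ∈ Finset.range (n + 1 + 1), PowerSeries.coeff k (scaleAt c s') -
      PowerSeries.coeff 1 c • (s - s') ∈ F (n + 1) := by
    rw [← Finset.sum_sub_distrib, Finset.sum_range_succ', Finset.sum_range_succ']
    simp only [coeff_scaleAt, ← smul_sub]
    rw [pow_zero, pow_zero, sub_self, smul_zero, add_zero, zero_add, pow_one, pow_one,
      add_sub_cancel_right]
    refine sum_mem fun k _ => smul_mem_filtration _ _ ?_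
    exact hF.antitone (by omega) (pow_sub_pow_mem_succ hF hs hs' h (k + 1))
  have := (F _).add_mem h1 h2
  rwa [← add_sub_assoc, sub_add_cancel] at this

/-- A series with linear coefficient `1` is injective on `F 1`. -/
theorem evalAt_injective (hF : IsCompleteFiltration F) (c : PowerSeries K)
    (hc : PowerSeries.coeff 1 c = 1) {s s' : A} (hs : s ∈ F 1) (hs' : s' ∈ F 1)
    (h : evalAt F c s = evalAt F c s') : s = s' := by
  refine hF.eq_of_sub_mem fun N hN => ?_
  induction N, hN using Nat.le_induction with
  | base => exact (F 1).sub_mem hs hs'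
  | succ N _ ih =>
    have := evalAt_sub_evalAt_mem hF c hs hs' ih
    rw [h, hc, one_smul, sub_self, zero_sub] at this
    simpa using (F _).neg_mem this

end Evaluation

end Series

end RotaBaxterBCH

namespace RotaBaxterBCH

/-! ### Exponential, logarithm and the BCH series on `F 1` -/

section LogExp

variable {A : Type*} [Ring A] {F : ℕ → TwoSidedIdeal A} (K : Type*) [Field K]

section EvalCoeffs

variable {K} [Algebra K A]

/-- The image of a series over `K⟨x, y⟩` under `x ↦ u`, `y ↦ v`. -/
noncomputable def evalCoeffs (u v : A) (f : PowerSeries (FreeAlgebra K (Fin 2))) :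
    PowerSeries A :=
  PowerSeries.map (FreeAlgebra.lift K ![u, v] : FreeAlgebra K (Fin 2) →ₐ[K] A).toRingHom f

theorem coeff_evalCoeffs (u v : A) (f : PowerSeries (FreeAlgebra K (Fin 2))) (n : ℕ) :
    PowerSeries.coeff n (evalCoeffs u v f) =
      FreeAlgebra.lift K ![u, v] (PowerSeries.coeff n f) := PowerSeries.coeff_map _ _ _

end EvalCoeffs

variable [CharZero K]

/-- Both sides have constant term zero and derivative one: the derivative of the logarithm is the
inverse of `1 + X`, which becomes the inverse of `exp` after substitution and cancels the derivative
of `exp - 1`. -/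
theorem log_subst_exp_sub_one :
    (PowerSeries.log K).subst (PowerSeries.exp K - 1) = PowerSeries.X := by
  have hE : PowerSeries.HasSubst (PowerSeries.exp K - 1) := PowerSeries.HasSubst.exp_sub_one
  have hL : (PowerSeries.mk fun n => algebraMap ℚ K ((-1 : ℚ) ^ n)) * (1 + PowerSeries.X) = 1 := by
    ext n
    rw [mul_add, mul_one, map_add, PowerSeries.coeff_mk]
    cases n with
    | zero => simp
    | succ n =>
      rw [PowerSeries.coeff_succ_mul_X, PowerSeries.coeff_mk, PowerSeries.coeff_one]
      simp [pow_succ]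
  refine PowerSeries.derivative.ext ?_ ?_
  · rw [PowerSeries.derivative_subst hE, PowerSeries.deriv_log]
    have h := congrArg (PowerSeries.subst (PowerSeries.exp K - 1)) hL
    rw [← PowerSeries.coe_substAlgHom hE, map_mul, map_add, map_one, PowerSeries.substAlgHom_X,
      add_sub_cancel] at h
    simpa [PowerSeries.derivative_exp, PowerSeries.coe_substAlgHom hE] using h
  · rw [PowerSeries.constantCoeff_X]
    refine PowerSeries.constantCoeff_subst_eq_zero ?_ _ PowerSeries.constantCoeff_log
    change PowerSeries.constantCoeff (PowerSeries.exp K - 1) = 0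
    simp

variable [Algebra K A]

theorem exp_eq_evalAt (F : ℕ → TwoSidedIdeal A) (a : A) :
    exp K F a = evalAt F (PowerSeries.exp K) a := by
  simp only [exp, evalAt, seriesSum, coeff_scaleAt, PowerSeries.coeff_exp]
  simp

variable {K}

theorem coeff_zero_exp_sub_one : PowerSeries.coeff 0 (PowerSeries.exp K - 1) = 0 := by
  simp

theorem evalAt_exp_sub_one (hF : IsCompleteFiltration F) {a : A} (ha : a ∈ F 1) :
    evalAt F (PowerSeries.exp K - 1) a = exp K F a - 1 := by
  rw [evalAt, scaleAt_sub, scaleAt_one, seriesSum_sub hF (seriesAdapted_scaleAt hF _ ha)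
    (seriesAdapted_one F), seriesSum_one hF, exp_eq_evalAt, evalAt]

theorem exp_sub_one_mem (hF : IsCompleteFiltration F) {a : A} (ha : a ∈ F 1) :
    exp K F a - 1 ∈ F 1 := by
  rw [← evalAt_exp_sub_one hF ha]
  exact evalAt_mem hF coeff_zero_exp_sub_one ha

theorem mul_sub_one_mem {I : TwoSidedIdeal A} {g h : A} (hg : g - 1 ∈ I) (hh : h - 1 ∈ I) :
    g * h - 1 ∈ I := by
  simpa using mul_sub_mul_mem hg hh

theorem exp_mul_exp_sub_one_mem (hF : IsCompleteFiltration F) {u v : A} (hu : u ∈ F 1)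
    (hv : v ∈ F 1) : exp K F u * exp K F v - 1 ∈ F 1 :=
  mul_sub_one_mem (exp_sub_one_mem hF hu) (exp_sub_one_mem hF hv)

variable (K) in
/-- The logarithm of an element of `1 + F 1`. -/
noncomputable def logAt (F : ℕ → TwoSidedIdeal A) (g : A) : A :=
  evalAt F (PowerSeries.log K) (g - 1)

theorem logAt_exp (hF : IsCompleteFiltration F) {a : A} (ha : a ∈ F 1) :
    logAt K F (exp K F a) = a := by
  rw [logAt, ← evalAt_exp_sub_one hF ha, ← evalAt_subst hF _ _ coeff_zero_exp_sub_one ha,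
    log_subst_exp_sub_one, evalAt, seriesSum_eq_coeff hF 1]
  · simp [coeff_scaleAt]
  · intro n hn
    rw [coeff_scaleAt, PowerSeries.coeff_X, if_neg hn, zero_smul]
  · simpa [coeff_scaleAt] using ha

theorem logAt_mem (hF : IsCompleteFiltration F) {g : A} (hg : g - 1 ∈ F 1) :
    logAt K F g ∈ F 1 :=
  evalAt_mem hF (by simp) hg

theorem logAt_injective (hF : IsCompleteFiltration F) {g h : A} (hg : g - 1 ∈ F 1)
    (hh : h - 1 ∈ F 1) (H : logAt K F g = logAt K F h) : g = h :=
  sub_left_inj.mp (evalAt_injective hF (PowerSeries.log K) PowerSeries.coeff_one_log hg hh H)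

/-- No second formal identity is needed: both sides have the same logarithm by `logAt_exp`, and the
logarithm is injective on `1 + F 1`. -/
theorem exp_logAt (hF : IsCompleteFiltration F) {g : A} (hg : g - 1 ∈ F 1) :
    exp K F (logAt K F g) = g :=
  logAt_injective hF (exp_sub_one_mem hF (logAt_mem hF hg)) hg (logAt_exp hF (logAt_mem hF hg))

theorem exp_eq_iff (hF : IsCompleteFiltration F) {a g : A} (ha : a ∈ F 1) (hg : g - 1 ∈ F 1) :
    exp K F a = g ↔ a = logAt K F g :=
  ⟨fun h => by rw [← h, logAt_exp hF ha], fun h => by rw [h, exp_logAt hF hg]⟩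

theorem exp_neg_mul_exp (hF : IsCompleteFiltration F) {a : A} (ha : a ∈ F 1) :
    exp K F (-a) * exp K F a = 1 := by
  have e : scaleAt (PowerSeries.exp K) (-a) =
      scaleAt (PowerSeries.evalNegHom (PowerSeries.exp K)) a := by
    ext n
    rw [coeff_scaleAt, coeff_scaleAt, PowerSeries.evalNegHom, PowerSeries.coeff_rescale,
      mul_comm, mul_smul, neg_pow]
    rcases neg_one_pow_eq_or A n with h | h <;> rcases n.even_or_odd with h' | h' <;>
      simp [h'.neg_one_pow]
  rw [exp_eq_evalAt, exp_eq_evalAt, evalAt, evalAt, e,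
    ← seriesSum_mul hF (seriesAdapted_scaleAt hF _ ha) (seriesAdapted_scaleAt hF _ ha),
    ← scaleAt_mul, mul_comm, PowerSeries.exp_mul_exp_neg_eq_one, scaleAt_one, seriesSum_one hF]

theorem exp_mul_exp_neg (hF : IsCompleteFiltration F) {a : A} (ha : a ∈ F 1) :
    exp K F a * exp K F (-a) = 1 := by
  simpa using exp_neg_mul_exp (K := K) hF ((F 1).neg_mem ha)

theorem evalCoeffs_formalExp (u v : A) (w : FreeAlgebra K (Fin 2)) :
    evalCoeffs u v (formalExp K w) =
      scaleAt (PowerSeries.exp K) (FreeAlgebra.lift K ![u, v] w) := by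
  ext n
  rw [coeff_evalCoeffs, formalExp, PowerSeries.coeff_mk, coeff_scaleAt, map_smul, map_pow]
  simp

/-- The BCH series is the logarithm of a product of exponentials, without its linear part. -/
theorem BCH_eq (hF : IsCompleteFiltration F) {u v : A} (hu : u ∈ F 1) (hv : v ∈ F 1) :
    BCH K F u v = logAt K F (exp K F u * exp K F v) - u - v := by
  set f : PowerSeries (FreeAlgebra K (Fin 2)) :=
    formalExp K (FreeAlgebra.ι K 0) * formalExp K (FreeAlgebra.ι K 1) with hf
  set g : PowerSeries A := scaleAt (PowerSeries.exp K) u * scaleAt (PowerSeries.exp K) v with hg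
  have hfg : evalCoeffs u v f = g := by
    rw [hf, evalCoeffs, map_mul, ← evalCoeffs, ← evalCoeffs, evalCoeffs_formalExp,
      evalCoeffs_formalExp, hg]
    simp
  have hgad : SeriesAdapted F g :=
    (seriesAdapted_scaleAt hF _ hu).mul hF (seriesAdapted_scaleAt hF _ hv)
  have hg1 : SeriesAdapted F (g - 1) := hgad.sub (seriesAdapted_one F)
  have hg0 : PowerSeries.coeff 0 (g - 1) = 0 := by
    rw [map_sub, hg, PowerSeries.coeff_mul]
    simp [coeff_scaleAt]
  have hlog : evalCoeffs u v (formalLog K f) = PowerSeries.mk fun n =>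
      ∑ k ∈ Finset.range (n + 1), PowerSeries.coeff k (PowerSeries.log K) •
        PowerSeries.coeff n ((g - 1) ^ k) := by
    have hp : ∀ k, evalCoeffs u v ((f - 1) ^ k) = (g - 1) ^ k := fun k => by
      rw [← hfg, evalCoeffs, evalCoeffs, map_pow, map_sub, map_one]
    ext n
    rw [coeff_evalCoeffs, formalLog, PowerSeries.coeff_mk, PowerSeries.coeff_mk, map_sum,
      Finset.sum_range_succ', PowerSeries.coeff_log, if_pos rfl, zero_smul, add_zero,
      Finset.range_eq_Ico, Finset.sum_Ico_add' (fun k => PowerSeries.coeff k (PowerSeries.log K) •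
        PowerSeries.coeff n ((g - 1) ^ k))]
    refine Finset.sum_congr (by ext k; simp) fun k hk => ?_
    rw [Finset.mem_Ico] at hk
    rw [map_smul, ← coeff_evalCoeffs, hp, PowerSeries.coeff_log, if_neg (by omega)]
    simp
  have hsum : seriesSum F (evalCoeffs u v (formalLog K f)) =
      logAt K F (exp K F u * exp K F v) := by
    rw [hlog, seriesSum_comp hF _ hg1 hg0, seriesSum_sub hF hgad (seriesAdapted_one F),
      seriesSum_one hF, hg, seriesSum_mul hF (seriesAdapted_scaleAt hF _ hu)
      (seriesAdapted_scaleAt hF _ hv), logAt, exp_eq_evalAt, exp_eq_evalAt]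
    rfl
  have hlad : SeriesAdapted F (evalCoeffs u v (formalLog K f)) := by
    rw [hlog]
    intro n hn
    rw [PowerSeries.coeff_mk]
    exact sum_mem fun k _ => smul_mem_filtration _ _ (hg1.pow hF k n hn)
  -- The linear part `x + y` removed from the BCH series, as a series concentrated in degree one.
  set l : PowerSeries A := PowerSeries.monomial 1 (u + v) with hl
  have hl0 : ∀ n, n ≠ 1 → PowerSeries.coeff n l = 0 := fun n hn => by
    rw [hl, PowerSeries.coeff_monomial, if_neg hn]
  have hl1 : PowerSeries.coeff 1 l = u + v := by rw [hl, PowerSeries.coeff_monomial_same]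
  have huv : u + v ∈ F 1 := (F 1).add_mem hu hv
  have hlad' : SeriesAdapted F l := fun n _ => by
    rcases eq_or_ne n 1 with rfl | h
    · rwa [hl1]
    · rw [hl0 n h]; exact (F n).zero_mem
  have hB : BCH K F u v = seriesSum F (evalCoeffs u v (formalLog K f) - l) := by
    rw [BCH, seriesSum]
    congr 1
    ext N
    refine Finset.sum_congr rfl fun n _ => ?_
    rw [bchComponent, ← hf, map_sub, map_sub, coeff_evalCoeffs]
    congr 1
    split_ifs with h
    · rw [h, hl1]; simp
    · rw [hl0 n h, map_zero]
  rw [hB, seriesSum_sub hF hlad hlad', hsum, seriesSum_eq_coeff hF 1 hl0 (by rwa [hl1]), hl1,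
    sub_sub]

theorem BCH_mem (hF : IsCompleteFiltration F) {u v : A} (hu : u ∈ F 1) (hv : v ∈ F 1) :
    BCH K F u v ∈ F 1 := by
  rw [BCH_eq hF hu hv]
  exact (F 1).sub_mem ((F 1).sub_mem (logAt_mem hF (exp_mul_exp_sub_one_mem hF hu hv)) hu) hv

theorem exp_sub_exp_mem (hF : IsCompleteFiltration F) {u u' : A} (hu : u ∈ F 1) (hu' : u' ∈ F 1)
    {n : ℕ} (h : u - u' ∈ F n) : exp K F u - exp K F u' - (u - u') ∈ F (n + 1) := by
  have := evalAt_sub_evalAt_mem hF (PowerSeries.exp K) hu hu' h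
  simpa [← exp_eq_evalAt] using this

/-- The BCH series has no linear part: it raises congruences by one step. -/
theorem BCH_sub_BCH_mem (hF : IsCompleteFiltration F) {u u' v v' : A} (hu : u ∈ F 1)
    (hu' : u' ∈ F 1) (hv : v ∈ F 1) (hv' : v' ∈ F 1) {n : ℕ} (h : u - u' ∈ F n)
    (h' : v - v' ∈ F n) : BCH K F u v - BCH K F u' v' ∈ F (n + 1) := by
  set g := exp K F u with hg
  set g' := exp K F u' with hg'
  set k := exp K F v with hk
  set k' := exp K F v' with hk'
  have e1 := exp_sub_exp_mem (K := K) hF hu hu' h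
  have e2 := exp_sub_exp_mem (K := K) hF hv hv' h'
  have m1 : g - g' ∈ F n := by
    simpa using (F n).add_mem (hF.antitone (Nat.le_succ n) e1) h
  have m2 : k - k' ∈ F n := by
    simpa using (F n).add_mem (hF.antitone (Nat.le_succ n) e2) h'
  have m3 : (g * k - 1) - (g' * k' - 1) ∈ F n := by
    rw [sub_sub_sub_cancel_right]; exact mul_sub_mul_mem m1 m2
  have e3 : g * k - g' * k' - (g - g') - (k - k') ∈ F (n + 1) := by
    -- Each product on the right has a factor in `F 1` besides a difference in `F n`, so to first
    -- order the product `g * k` behaves additively.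
    have e : g * k - g' * k' - (g - g') - (k - k') =
        (g - g') * (k - 1) + (g' - 1) * (k - k') := by noncomm_ring
    rw [e]
    refine (F _).add_mem (hF.mul_mem m1 (exp_sub_one_mem hF hv)) ?_
    rw [add_comm n]
    exact hF.mul_mem (exp_sub_one_mem hF hu') m2
  have e4 := evalAt_sub_evalAt_mem hF (PowerSeries.log K) (exp_mul_exp_sub_one_mem hF hu hv)
    (exp_mul_exp_sub_one_mem hF hu' hv') m3
  rw [PowerSeries.coeff_one_log, one_smul, sub_sub_sub_cancel_right, ← logAt, ← logAt] at e4
  rw [BCH_eq hF hu hv, BCH_eq hF hu' hv']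
  -- The four error terms telescope from the logarithm through the product and the exponentials to
  -- the linear terms `u - u'` and `v - v'`.
  have := (F _).add_mem ((F _).add_mem e4 e3) ((F _).add_mem e1 e2)
  convert this using 1
  abel

end LogExp

end RotaBaxterBCH

namespace RotaBaxterBCH

/-! ### Rota-Baxter operators, the double product and the linear equations -/

section RotaBaxter

variable {A : Type*} [Ring A] {F : ℕ → TwoSidedIdeal A} {K : Type*} [Field K] [Algebra K A]

theorem tildeOp_apply (θ : K) (P : A →ₗ[K] A) (x : A) : tildeOp θ P x = θ • x - P x := rfl

theorem tildeOp_tildeOp (θ : K) (P : A →ₗ[K] A) : tildeOp θ (tildeOp θ P) = P :=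
  sub_sub_cancel _ _

theorem tildeOp_mem {θ : K} {P : A →ₗ[K] A} (hP : IsCompleteFilteredRotaBaxter F θ P) {n : ℕ}
    {x : A} (hx : x ∈ F n) : tildeOp θ P x ∈ F n :=
  (F n).sub_mem (smul_mem_filtration _ _ hx) (hP.map_mem n x hx)

/-- The operator `θ id - P` is a Rota-Baxter operator of the same weight. -/
theorem IsCompleteFilteredRotaBaxter.tilde {θ : K} {P : A →ₗ[K] A}
    (hP : IsCompleteFilteredRotaBaxter F θ P) :
    IsCompleteFilteredRotaBaxter F θ (tildeOp θ P) := by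
  refine ⟨hP.complete, fun x y => ?_, fun n x hx => tildeOp_mem hP hx⟩
  have h := hP.rotaBaxter x y
  simp only [tildeOp_apply, mul_sub, sub_mul, smul_sub, map_sub, map_smul, smul_mul_assoc,
    mul_smul_comm]
  rw [← sub_eq_zero] at h ⊢
  rw [← h]
  abel

/-- The powers of `c` for the product `x ∗ y = P x * y + x * P y - θ • x * y`; the exponent is
shifted by one. -/
def doublePow (θ : K) (P : A →ₗ[K] A) (c : A) : ℕ → A
  | 0 => c
  | n + 1 => P c * doublePow θ P c n + c * P (doublePow θ P c n) - θ • (c * doublePow θ P c n)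

/-- The Rota-Baxter identity says precisely that `P` is multiplicative from the double product to
the product of `A`. -/
theorem map_doublePow {θ : K} {P : A →ₗ[K] A} (hP : IsRotaBaxter θ P) (c : A) (n : ℕ) :
    P (doublePow θ P c n) = P c ^ (n + 1) := by
  induction n with
  | zero => rw [doublePow, zero_add, pow_one]
  | succ n ih =>
    rw [doublePow, map_sub, map_add, map_smul, add_comm, ← hP, add_sub_cancel_right, ih,
      pow_succ' _ (n + 1)]

/-- The two signs express that it is `-tildeOp θ P` that is multiplicative for the double product.
-/
theorem tildeOp_doublePow {θ : K} {P : A →ₗ[K] A} (hP : IsRotaBaxter θ P) (c : A) (n : ℕ) :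
    tildeOp θ P (doublePow θ P c n) = -(-tildeOp θ P c) ^ (n + 1) := by
  induction n with
  | zero => simp [doublePow]
  | succ n ih =>
    rw [pow_succ' _ (n + 1), neg_mul_comm, ← ih, tildeOp_apply θ P c, tildeOp_apply, tildeOp_apply,
      map_doublePow hP, doublePow, map_doublePow hP, pow_succ' (P c) (n + 1)]
    simp only [mul_sub, sub_mul, smul_sub, smul_add, smul_mul_assoc, mul_smul_comm]
    abel

theorem doublePow_mem {θ : K} {P : A →ₗ[K] A} (hP : IsCompleteFilteredRotaBaxter F θ P) {c : A}
    (hc : c ∈ F 1) (n : ℕ) : doublePow θ P c n ∈ F (n + 1) := by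
  induction n with
  | zero => exact hc
  | succ n ih =>
    rw [doublePow, add_comm (n + 1) 1]
    exact (F _).sub_mem ((F _).add_mem (hP.complete.mul_mem (hP.map_mem _ _ hc) ih)
      (hP.complete.mul_mem hc (hP.map_mem _ _ ih)))
      (smul_mem_filtration _ _ (hP.complete.mul_mem hc ih))

theorem map_seriesSum (hF : IsCompleteFiltration F) {Q : A →ₗ[K] A}
    (hQ : ∀ n, ∀ x ∈ F n, Q x ∈ F n) {g h : PowerSeries A} (hg : SeriesAdapted F g)
    (hgh : ∀ n, PowerSeries.coeff n h = Q (PowerSeries.coeff n g)) :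
    seriesSum F h = Q (seriesSum F g) := by
  refine seriesSum_eq hF (fun n hn => hgh n ▸ hQ n _ (hg n hn)) fun N hN => ?_
  simp only [hgh]
  rw [← map_sum, ← map_sub]
  exact hQ N _ (sum_range_sub_seriesSum_mem hF hg hN)

/-- The exponentials of `-P c` and `θ c - P c` are given by one and the same element. -/
theorem exists_exp_neg_eq [CharZero K] {θ : K} {P : A →ₗ[K] A}
    (hP : IsCompleteFilteredRotaBaxter F θ P) {c : A} (hc : c ∈ F 1) :
    ∃ d : A, exp K F (-P c) = 1 + P d ∧ exp K F (tildeOp θ P c) = 1 - tildeOp θ P d := by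
  have hF := hP.complete
  -- Coefficients `(-1)^n / n!` make `P` produce `exp (-P c) - 1` and `-tildeOp θ P` produce `exp
  -- (tildeOp θ P c) - 1`. The exponent of `doublePow` is shifted by one; at `n = 0` the truncated
  -- `n - 1` is harmless since `exp - 1` has no constant term.
  set D : PowerSeries A := PowerSeries.mk fun n =>
    ((-1 : K) ^ n * PowerSeries.coeff n (PowerSeries.exp K - 1)) • doublePow θ P c (n - 1) with hD
  have hD0 : PowerSeries.coeff 0 D = 0 := by
    rw [hD, PowerSeries.coeff_mk, coeff_zero_exp_sub_one, mul_zero, zero_smul]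
  have hDs : ∀ n, PowerSeries.coeff (n + 1) D =
      ((-1 : K) ^ (n + 1) * PowerSeries.coeff (n + 1) (PowerSeries.exp K - 1)) •
        doublePow θ P c n := fun n => PowerSeries.coeff_mk _ _
  have had : SeriesAdapted F D := fun n hn => by
    obtain ⟨m, rfl⟩ : ∃ m, n = m + 1 := ⟨n - 1, by omega⟩
    rw [hDs]
    exact smul_mem_filtration _ _ (doublePow_mem hP hc m)
  refine ⟨seriesSum F D, ?_, ?_⟩
  · rw [← sub_eq_iff_eq_add', ← evalAt_exp_sub_one hF ((F 1).neg_mem (hP.map_mem 1 c hc))]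
    refine map_seriesSum hF hP.map_mem had fun n => ?_
    cases n with
    | zero => rw [hD0, map_zero, coeff_scaleAt, coeff_zero_exp_sub_one, zero_smul]
    | succ n =>
      rw [hDs, map_smul, map_doublePow hP.rotaBaxter, coeff_scaleAt, mul_comm, mul_smul,
        ← neg_one_smul K (P c), smul_pow]
  · rw [sub_eq_add_neg, ← map_neg, ← sub_eq_iff_eq_add',
      ← evalAt_exp_sub_one hF (tildeOp_mem hP hc), map_neg, ← LinearMap.neg_apply]
    refine map_seriesSum hF (fun n x hx => (F n).neg_mem (tildeOp_mem hP hx)) had fun n => ?_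
    cases n with
    | zero => rw [hD0, map_zero, coeff_scaleAt, coeff_zero_exp_sub_one, zero_smul]
    | succ n =>
      rw [hDs, map_smul, LinearMap.neg_apply, tildeOp_doublePow hP.rotaBaxter, neg_neg,
        coeff_scaleAt, mul_comm, ← neg_one_smul K (tildeOp θ P c), smul_pow, smul_smul,
        mul_assoc, ← mul_pow, neg_one_mul, neg_neg, one_pow, mul_one]

/-- A map `z ↦ w + T z` with `T` additive and raising the filtration has at most one fixed
point. -/
theorem eq_of_eq_add (hF : IsCompleteFiltration F) {T : A → A}
    (h1 : ∀ x y, T x - T y ∈ F 1) (hT : ∀ n x y, 1 ≤ n → x - y ∈ F n → T x - T y ∈ F (n + 1))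
    {x y : A} (hx : x = T x) (hy : y = T y) : x = y := by
  refine hF.eq_of_sub_mem fun N hN => ?_
  induction N, hN using Nat.le_induction with
  | base => rw [hx, hy]; exact h1 x y
  | succ N hN ih => rw [hx, hy]; exact hT N x y hN ih

/-- The linear equation for the inverse of the first factor has at most one solution. -/
theorem eq_one_sub_mul_right_unique (hF : IsCompleteFiltration F) {Q : A →ₗ[K] A}
    (hQ : ∀ n, ∀ x ∈ F n, Q x ∈ F n) {b x y : A} (hb : b ∈ F 1) (hx : x = 1 - Q (x * b))
    (hy : y = 1 - Q (y * b)) : x = y := by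
  have e : ∀ x y, (1 - Q (x * b)) - (1 - Q (y * b)) = Q ((y - x) * b) := fun x y => by
    rw [sub_sub_sub_cancel_left, ← map_sub, ← sub_mul]
  refine eq_of_eq_add hF (T := fun z => 1 - Q (z * b)) (fun x y => ?_) (fun n x y _ h => ?_) hx hy
  · rw [e]; exact hQ 1 _ ((F 1).mul_mem_left _ _ hb)
  · rw [e]; exact hQ _ _ (hF.mul_mem (sub_mem_symm h) hb)

/-- The linear equation for the inverse of the second factor has at most one solution. -/
theorem eq_one_sub_mul_left_unique (hF : IsCompleteFiltration F) {Q : A →ₗ[K] A}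
    (hQ : ∀ n, ∀ x ∈ F n, Q x ∈ F n) {b x y : A} (hb : b ∈ F 1) (hx : x = 1 - Q (b * x))
    (hy : y = 1 - Q (b * y)) : x = y := by
  have e : ∀ x y, (1 - Q (b * x)) - (1 - Q (b * y)) = Q (b * (y - x)) := fun x y => by
    rw [sub_sub_sub_cancel_left, ← map_sub, ← mul_sub]
  refine eq_of_eq_add hF (T := fun z => 1 - Q (b * z)) (fun x y => ?_) (fun n x y _ h => ?_) hx hy
  · rw [e]; exact hQ 1 _ ((F 1).mul_mem_right _ _ hb)
  · rw [e, add_comm]; exact hQ _ _ (hF.mul_mem hb (sub_mem_symm h))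

/-! ### The BCH-recursion, its fixed point and the factorization -/

section Recursion

variable [CharZero K] {θ : K} {P : A →ₗ[K] A}

/-- One step of the BCH-recursion. -/
noncomputable def chiStep (F : ℕ → TwoSidedIdeal A) (θ : K) (P : A →ₗ[K] A) (a c : A) : A :=
  a - θ⁻¹ • BCH K F (P c) (tildeOp θ P c)

theorem chiStep_mem (hP : IsCompleteFilteredRotaBaxter F θ P) {a c : A} (ha : a ∈ F 1)
    (hc : c ∈ F 1) : chiStep F θ P a c ∈ F 1 :=
  (F 1).sub_mem ha (smul_mem_filtration _ _
    (BCH_mem hP.complete (hP.map_mem _ _ hc) (tildeOp_mem hP hc)))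

/-- The contraction property behind convergence and uniqueness: `a` cancels, the linear operators
preserve the filtration, and BCH gains one step. -/
theorem chiStep_sub_chiStep_mem (hP : IsCompleteFilteredRotaBaxter F θ P) (a : A) {c c' : A}
    (hc : c ∈ F 1) (hc' : c' ∈ F 1) {n : ℕ} (h : c - c' ∈ F n) :
    chiStep F θ P a c - chiStep F θ P a c' ∈ F (n + 1) := by
  rw [chiStep, chiStep, sub_sub_sub_cancel_left, ← smul_sub]
  refine smul_mem_filtration _ _ (sub_mem_symm (BCH_sub_BCH_mem hP.complete (hP.map_mem _ _ hc)
    (hP.map_mem _ _ hc') (tildeOp_mem hP hc) (tildeOp_mem hP hc') ?_ ?_))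
  · rw [← map_sub]; exact hP.map_mem _ _ h
  · rw [← map_sub]; exact tildeOp_mem hP h

theorem chiIter_mem (hP : IsCompleteFilteredRotaBaxter F θ P) {a : A} (ha : a ∈ F 1) (n : ℕ) :
    chiIter F θ P a n ∈ F 1 := by
  induction n with
  | zero => exact ha
  | succ n ih => exact chiStep_mem hP ha ih

theorem chiIter_succ_sub_mem (hP : IsCompleteFilteredRotaBaxter F θ P) {a : A} (ha : a ∈ F 1)
    (n : ℕ) : chiIter F θ P a (n + 1) - chiIter F θ P a n ∈ F (n + 1) := by
  induction n with
  | zero => exact (F 1).sub_mem (chiIter_mem hP ha 1) (chiIter_mem hP ha 0)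
  | succ n ih =>
    exact chiStep_sub_chiStep_mem hP a (chiIter_mem hP ha (n + 1)) (chiIter_mem hP ha n) ih

theorem convergesTo_chi (hP : IsCompleteFilteredRotaBaxter F θ P) {a : A} (ha : a ∈ F 1) :
    ConvergesTo F (chiIter F θ P a) (chi F θ P a) := by
  refine convergesTo_limit ?_
  obtain ⟨l, hl⟩ := hP.complete.exists_lim (chiIter F θ P a) fun n =>
    hP.complete.antitone (Nat.le_succ n) (chiIter_succ_sub_mem hP ha n)
  refine ⟨l, fun N => ?_⟩
  filter_upwards [Filter.eventually_ge_atTop N] with n hn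
  exact sub_mem_symm (hP.complete.antitone hn (hl n))

theorem chi_mem (hP : IsCompleteFilteredRotaBaxter F θ P) {a : A} (ha : a ∈ F 1) :
    chi F θ P a ∈ F 1 := by
  obtain ⟨n, hn⟩ := (convergesTo_chi hP ha 1).exists
  simpa using (F 1).sub_mem (chiIter_mem hP ha n) hn

theorem chi_eq_chiStep (hP : IsCompleteFilteredRotaBaxter F θ P) {a : A} (ha : a ∈ F 1) :
    chi F θ P a = chiStep F θ P a (chi F θ P a) := by
  refine hP.complete.eq_of_sub_mem fun N _ => ?_
  have h := convergesTo_chi hP ha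
  obtain ⟨n, hn, hn'⟩ := ((h N).and ((Filter.tendsto_add_atTop_nat 1).eventually (h N))).exists
  refine sub_mem_trans (sub_mem_symm hn') (hP.complete.antitone (Nat.le_succ N) ?_)
  exact chiStep_sub_chiStep_mem hP a (chiIter_mem hP ha n) (chi_mem hP ha) hn

theorem eq_chiStep_iff (hP : IsCompleteFilteredRotaBaxter F θ P) {a c : A} (ha : a ∈ F 1)
    (hc : c ∈ F 1) : c = chiStep F θ P a c ↔ c = chi F θ P a := by
  refine ⟨fun h => hP.complete.eq_of_sub_mem fun N hN => ?_, fun h => h ▸ chi_eq_chiStep hP ha⟩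
  induction N, hN using Nat.le_induction with
  | base => exact (F 1).sub_mem hc (chi_mem hP ha)
  | succ N _ ih =>
    rw [h, chi_eq_chiStep hP ha]
    exact chiStep_sub_chiStep_mem hP a hc (chi_mem hP ha) ih

/-- The recursive equation is equivalent to the factorization of `exp (θ a)`. -/
theorem eq_chiStep_iff_exp (hP : IsCompleteFilteredRotaBaxter F θ P) (hθ : θ ≠ 0) {a c : A}
    (ha : a ∈ F 1) (hc : c ∈ F 1) :
    c = chiStep F θ P a c ↔
      exp K F (θ • a) = exp K F (P c) * exp K F (tildeOp θ P c) := by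
  have hF := hP.complete
  have hu := hP.map_mem _ _ hc
  have hv := tildeOp_mem hP hc
  -- After taking logarithms, `P c` cancels in `P c + (θ • c - P c)`, and both sides say that `θ •
  -- a` is the logarithm of the product.
  rw [exp_eq_iff hF (smul_mem_filtration _ _ ha) (exp_mul_exp_sub_one_mem hF hu hv), chiStep,
    BCH_eq hF hu hv, sub_sub, tildeOp_apply, add_sub_cancel, eq_sub_iff_add_eq, smul_sub,
    inv_smul_smul₀ hθ, add_sub_cancel, inv_smul_eq_iff₀ hθ, eq_comm]

/-- The second recursive equation is equivalent to the factorization of `exp (θ a)`. -/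
theorem eq_add_BCH_iff_exp (hP : IsCompleteFilteredRotaBaxter F θ P) (hθ : θ ≠ 0) {a c : A}
    (ha : a ∈ F 1) (hc : c ∈ F 1) :
    c = a + θ⁻¹ • BCH K F (-P c) (θ • a) ↔
      exp K F (θ • a) = exp K F (P c) * exp K F (tildeOp θ P c) := by
  have hF := hP.complete
  have hu := hP.map_mem _ _ hc
  have hu' := (F 1).neg_mem hu
  have hv := tildeOp_mem hP hc
  have hw : θ • a ∈ F 1 := smul_mem_filtration _ _ ha
  have e : exp K F (θ • a) = exp K F (P c) * exp K F (tildeOp θ P c) ↔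
      exp K F (tildeOp θ P c) = exp K F (-P c) * exp K F (θ • a) := by
    constructor
    · intro h
      rw [h, ← mul_assoc, exp_neg_mul_exp hF hu, one_mul]
    · intro h
      rw [h, ← mul_assoc, exp_mul_exp_neg hF hu, one_mul]
  -- The logarithm of the rewritten factorization reads `θ • c - P c = -P c + θ • a + BCH (-P c) (θ
  -- • a)`; cancel `-P c` and divide by `θ`.
  rw [e, exp_eq_iff hF hv (exp_mul_exp_sub_one_mem hF hu' hw), BCH_eq hF hu' hw, sub_neg_eq_add,
    smul_sub, inv_smul_smul₀ hθ, add_sub_cancel, eq_inv_smul_iff₀ hθ, tildeOp_apply,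
    sub_eq_iff_eq_add]

/-- The inverses of the two factors of `1 + θ b` solve the two linear equations. -/
theorem exp_neg_eq_one_sub (hP : IsCompleteFilteredRotaBaxter F θ P) (hθ : θ ≠ 0) {b c : A}
    (hc : c ∈ F 1) (h : 1 + θ • b = exp K F (P c) * exp K F (tildeOp θ P c)) :
    exp K F (-P c) = 1 - P (exp K F (-P c) * b) ∧
      exp K F (-tildeOp θ P c) = 1 - tildeOp θ P (b * exp K F (-tildeOp θ P c)) := by
  have hF := hP.complete
  have hinj : Function.Injective (θ • · : A → A) := fun x y hxy =>
    smul_right_injective A hθ hxy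
  constructor
  · obtain ⟨d, h1, h2⟩ := exists_exp_neg_eq hP hc
    have h3 : exp K F (-P c) * (1 + θ • b) = exp K F (tildeOp θ P c) := by
      rw [h, ← mul_assoc, exp_neg_mul_exp hF (hP.map_mem _ _ hc), one_mul]
    -- By `h3`, `θ • (exp (-P c) * b)` is `exp (tildeOp θ P c) - exp (-P c)`, that is `-(tildeOp θ P
    -- d + P d) = -θ • d`.
    have h4 : exp K F (-P c) * b = -d := hinj <| by
      change θ • (exp K F (-P c) * b) = θ • -d
      rw [mul_add, mul_one, mul_smul_comm, ← eq_sub_iff_add_eq'] at h3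
      rw [h3, h1, h2, tildeOp_apply, smul_neg]
      abel
    rw [h4, map_neg, sub_neg_eq_add, h1]
  -- The roles of `P` and `tildeOp θ P` are exchanged, and the inverse factor is now cancelled on
  -- the right.
  · obtain ⟨d, h1, h2⟩ := exists_exp_neg_eq hP.tilde hc
    rw [tildeOp_tildeOp] at h2
    have h3 : (1 + θ • b) * exp K F (-tildeOp θ P c) = exp K F (P c) := by
      rw [h, mul_assoc, exp_mul_exp_neg hF (tildeOp_mem hP hc), mul_one]
    have h4 : b * exp K F (-tildeOp θ P c) = -d := hinj <| by
      change θ • (b * exp K F (-tildeOp θ P c)) = θ • -d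
      rw [add_mul, one_mul, smul_mul_assoc, ← eq_sub_iff_add_eq'] at h3
      rw [h3, h1, h2, tildeOp_apply, smul_neg]
      abel
    rw [h4, map_neg, sub_neg_eq_add, h1]

end Recursion

end RotaBaxter

end RotaBaxterBCH

theorem mainTheorem8 {K : Type*} [Field K] [CharZero K] {A : Type*} [Ring A] [Algebra K A]
    (F : ℕ → TwoSidedIdeal A) (θ : K) (hθ : θ ≠ 0) (P : A →ₗ[K] A)
    (hP : RotaBaxterBCH.IsCompleteFilteredRotaBaxter F θ P) (a : A) (ha : a ∈ F 1) :
    -- the recursion converges in `F 1`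
    RotaBaxterBCH.chi F θ P a ∈ F 1 ∧
    RotaBaxterBCH.ConvergesTo F (RotaBaxterBCH.chiIter F θ P a) (RotaBaxterBCH.chi F θ P a) ∧
    -- its limit is the unique solution in `F 1` of each of the two recursive equations
    (∀ c ∈ F 1,
      c = a - θ⁻¹ • RotaBaxterBCH.BCH K F (P c) (RotaBaxterBCH.tildeOp θ P c) ↔
        c = RotaBaxterBCH.chi F θ P a) ∧
    (∀ c ∈ F 1,
      c = a + θ⁻¹ • RotaBaxterBCH.BCH K F (-P c) (θ • a) ↔
        c = RotaBaxterBCH.chi F θ P a) ∧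
    -- the factorization
    RotaBaxterBCH.exp K F (θ • a) =
      RotaBaxterBCH.exp K F (P (RotaBaxterBCH.chi F θ P a)) *
        RotaBaxterBCH.exp K F (RotaBaxterBCH.tildeOp θ P (RotaBaxterBCH.chi F θ P a)) ∧
    -- the factors are the inverses of the unique solutions of the two linear equations
    ∃ b ∈ F 1, 1 + θ • b = RotaBaxterBCH.exp K F (θ • a) ∧
      ∃ x x' : A,
        (∀ z : A, z = 1 - P (z * b) ↔ z = x) ∧
        (∀ z : A, z = 1 - RotaBaxterBCH.tildeOp θ P (b * z) ↔ z = x') ∧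
        x * RotaBaxterBCH.exp K F (P (RotaBaxterBCH.chi F θ P a)) = 1 ∧
        RotaBaxterBCH.exp K F (P (RotaBaxterBCH.chi F θ P a)) * x = 1 ∧
        x' * RotaBaxterBCH.exp K F (RotaBaxterBCH.tildeOp θ P (RotaBaxterBCH.chi F θ P a)) = 1 ∧
        RotaBaxterBCH.exp K F (RotaBaxterBCH.tildeOp θ P (RotaBaxterBCH.chi F θ P a)) * x' = 1 := by
  have hF := hP.complete
  have hc := RotaBaxterBCH.chi_mem hP ha
  have hu := hP.map_mem _ _ hc
  have hv := RotaBaxterBCH.tildeOp_mem hP hc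
  have hfac := (RotaBaxterBCH.eq_chiStep_iff_exp hP hθ ha hc).mp
    (RotaBaxterBCH.chi_eq_chiStep hP ha)
  have hb : θ⁻¹ • (RotaBaxterBCH.exp K F (θ • a) - 1) ∈ F 1 :=
    RotaBaxterBCH.smul_mem_filtration _ _ (RotaBaxterBCH.exp_sub_one_mem hF
      (RotaBaxterBCH.smul_mem_filtration _ _ ha))
  have hb1 : 1 + θ • θ⁻¹ • (RotaBaxterBCH.exp K F (θ • a) - 1) =
      RotaBaxterBCH.exp K F (θ • a) := by
    rw [smul_inv_smul₀ hθ, add_sub_cancel]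
  obtain ⟨hx, hx'⟩ := RotaBaxterBCH.exp_neg_eq_one_sub hP hθ hc (hb1.trans hfac)
  refine ⟨hc, RotaBaxterBCH.convergesTo_chi hP ha,
    fun c hc => RotaBaxterBCH.eq_chiStep_iff hP ha hc, fun c hc => ?_, hfac,
    _, hb, hb1, _, _, fun z => ⟨fun hz => ?_, fun hz => hz ▸ hx⟩,
    fun z => ⟨fun hz => ?_, fun hz => hz ▸ hx'⟩,
    RotaBaxterBCH.exp_neg_mul_exp hF hu, RotaBaxterBCH.exp_mul_exp_neg hF hu,
    RotaBaxterBCH.exp_neg_mul_exp hF hv, RotaBaxterBCH.exp_mul_exp_neg hF hv⟩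
  -- The two recursive equations are compared through the factorization of `exp (θ a)`.
  · rw [RotaBaxterBCH.eq_add_BCH_iff_exp hP hθ ha hc,
      ← RotaBaxterBCH.eq_chiStep_iff_exp hP hθ ha hc, RotaBaxterBCH.eq_chiStep_iff hP ha hc]
  · exact RotaBaxterBCH.eq_one_sub_mul_right_unique hF hP.map_mem hb hz hx
  · exact RotaBaxterBCH.eq_one_sub_mul_left_unique hF
      (fun n x hx => RotaBaxterBCH.tildeOp_mem hP hx) hb hz hx'
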